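/- Let $m^\pm\ge 1$ be integers, $\alpha_0^\pm,\beta_0^\pm\in\mathbb R$, $\alpha^\pm,\beta^\pm\in\mathbb R^{m^\pm}$, and $\eta_i^\pm\in[-1,1]$ with $\eta_i^+\neq 1$, $\eta_i^-\neq -1$. Consider the eigenvalue problem $$-u''=\lambda u\ \text{ on }(-1,1),\qquad \alpha_0^\pm u(\pm1)+\beta_0^\pm u'(\pm1)=\sum_{i=1}^{m^\pm}\alpha_i^\pm u(\eta_i^\pm)+\sum_{i=1}^{m^\pm}\beta_i^\pm u'(\eta_i^\pm),\qquad(\ast)$$ for $\lambda\in\mathbb R$ and real $u\in C^2[-1,1]$. Assume $$\alpha_0^\pm\ge0,\quad \alpha_0^\pm+|\beta_0^\pm|>0,\quad \pm\beta_0^\pm\ge0,\quad \Big(\tfrac{\sum_i|\alpha_i^\pm|}{\alpha_0^\pm}\Big)^2+\Big(\tfrac{\sum_i|\beta_i^\pm|}{\beta_0^\pm}\Big)^2<1,$$ where, if a denominator in the last condition is zero, then its numerator must be zero too and the fraction is omitted. Assume also that $\alpha_i^\pm\ge0$ for $i=1,\dots,m^\pm$. An eigenvalue is a $\lambda\in\mathbb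 R$ for which $(\ast)$ has a non-trivial solution $u$ (an eigenfunction). For $\lambda>0$ let $\omega_{\lambda,0}^-\in[0,\pi/2]$ and $\omega_{\lambda,0}^+\in[\pi/2,\pi]$ be the angles, modulo $\pi$, of the vectors $(\alpha_0^\pm,-\lambda^{1/2}\beta_0^\pm)$. Let $P_0^+$ be the set of pairs $(\lambda,u)$ with $\lambda>0$, $u\in C^1[-1,1]$ having only simple zeros, for which some continuous choice $\omega(x)$ of the angle from $(1,0)$ to $(u'(x),\lambda^{1/2}u(x))$ satisfies $|\omega(\pm1)-\omega_{\lambda,0}^\pm|<\pi/2$. A principal eigenfunction is an eigenfunction $u_0$ of the least eigenvalue $\lambda_0$, with its sign normalized by $(\lambda_0,u_0)\in P_0^+$ if $\lambda_0>0$, and by $u_0(x)>0$ for some $x\in[-1,1]$ if $\lambda_0=0$. Then a principal eigenfunction $u_0$ exists and is unique up to multiplication by a positive constant, and: (a) $u_0>0$ on $(-1,1)$; (b) if $\beta_0^+\ne0$ then $u_0(1)>0$, and if $\beta_0^-\neq0$ then $u_0(-1)>0$. -/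

import Mathlib

open Set

noncomputable section

namespace MultiPoint

/-- The interval `[-1,1]`. -/
abbrev I : Set ℝ := Icc (-1) 1

/-- The derivative of a function on `[-1,1]`, one-sided at the end points. -/
def D (u : ℝ → ℝ) : ℝ → ℝ := derivWithin u I

/-- The data of one multi-point boundary condition: `α₀ u(ν) + β₀ u'(ν) = ∑ αᵢ u(ηᵢ) + ∑ βᵢ u'(ηᵢ)`,
posed at an end point `ν ∈ {-1, 1}`. (The case `m = 0` is the same as all `αᵢ = βᵢ = 0`.) -/
structure BC where
  m : ℕ
  α₀ : ℝ
  β₀ : ℝ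
  α : Fin m → ℝ
  β : Fin m → ℝ
  η : Fin m → ℝ

/-- The boundary condition `B`, posed at the end point `ν`, holds for `u`. -/
def BC.Holds (B : BC) (ν : ℝ) (u : ℝ → ℝ) : Prop :=
  B.α₀ * u ν + B.β₀ * D u ν = ∑ i, B.α i * u (B.η i) + ∑ i, B.β i * D u (B.η i)

/-- The standing assumptions on the boundary condition at the end point `ν ∈ {-1, 1}`.
In `ratio`, a fraction with denominator zero has the value `0` in Lean, so it is omitted from the
sum; its numerator has to vanish by `α_zero` or `β_zero`. -/
structure BC.Admissible (B : BC) (ν : ℝ) : Prop where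
  η_mem : ∀ i, B.η i ∈ I
  η_ne : ∀ i, B.η i ≠ ν
  α₀_nonneg : 0 ≤ B.α₀
  nontrivial : 0 < B.α₀ + |B.β₀|
  β₀_sign : 0 ≤ ν * B.β₀
  α_zero : B.α₀ = 0 → ∑ i, |B.α i| = 0
  β_zero : B.β₀ = 0 → ∑ i, |B.β i| = 0
  ratio : ((∑ i, |B.α i|) / B.α₀) ^ 2 + ((∑ i, |B.β i|) / B.β₀) ^ 2 < 1

/-- `u` is a non-trivial `C²[-1,1]` solution of `-u'' = lam u` satisfying the boundary conditions
`Bm` at `-1` and `Bp` at `1`. Only the values of `u` on `[-1,1]` matter. -/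
structure IsEigenfunction (Bm Bp : BC) (lam : ℝ) (u : ℝ → ℝ) : Prop where
  contDiffOn : ContDiffOn ℝ 2 u I
  eqn : ∀ x ∈ Ioo (-1 : ℝ) 1, -(D (D u) x) = lam * u x
  bc_minus : Bm.Holds (-1) u
  bc_plus : Bp.Holds 1 u
  nontrivial : ∃ x ∈ I, u x ≠ 0

/-- The set of (real) eigenvalues. -/
def spectrum (Bm Bp : BC) : Set ℝ := {lam | ∃ u, IsEigenfunction Bm Bp lam u}

/-- `u ∈ C¹[-1,1]` and `u` has only simple zeros. -/
def SimpleC1 (u : ℝ → ℝ) : Prop :=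
  ContDiffOn ℝ 1 u I ∧ ∀ x ∈ I, 0 < |u x| + |D u x|

/-- `ω` is a (modified) Prüfer angle of `u`: a continuous choice of the angle between the vectors
`(u'(x), lam^{1/2} u(x))` and `(1,0)`. -/
def IsPruferAngle (lam : ℝ) (u ω : ℝ → ℝ) : Prop :=
  ContinuousOn ω I ∧ ∀ x ∈ I,
    D u x = √(D u x ^ 2 + lam * u x ^ 2) * Real.cos (ω x) ∧
    √lam * u x = √(D u x ^ 2 + lam * u x ^ 2) * Real.sin (ω x)

/-- The angle of the vector `(α₀, -lam^{1/2} β₀)`; for an admissible condition at `-1` it lies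
in `[0, π/2]`. -/
def angleMinus (Bm : BC) (lam : ℝ) : ℝ := Complex.arg ⟨Bm.α₀, -(√lam * Bm.β₀)⟩

/-- The angle of the vector `(α₀, -lam^{1/2} β₀)`, modulo `π`; for an admissible condition at `1`
the value chosen here lies in `[π/2, π]`. -/
def anglePlus (Bp : BC) (lam : ℝ) : ℝ := Real.pi + Complex.arg ⟨Bp.α₀, -(√lam * Bp.β₀)⟩

/-- The pair `(lam, u)` belongs to the oscillation class `P_k^+`. -/
def MemP (Bm Bp : BC) (k : ℕ) (lam : ℝ) (u : ℝ → ℝ) : Prop :=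
  0 < lam ∧ SimpleC1 u ∧ ∃ ω : ℝ → ℝ, IsPruferAngle lam u ω ∧
    |ω (-1) - angleMinus Bm lam| < Real.pi / 2 ∧
    |ω 1 - anglePlus Bp lam - k * Real.pi| < Real.pi / 2

/-- `u` is a principal eigenfunction: an eigenfunction of the least eigenvalue `lam`, whose sign is
normalized by `(lam, u) ∈ P_0^+` if `lam > 0`. The class `P_0^+` is not defined for `lam = 0`;
there the sign is normalized by asking that `u` take some positive value. -/
def IsPrincipalEigenfunction (Bm Bp : BC) (u : ℝ → ℝ) : Prop :=
  ∃ lam, IsLeast (spectrum Bm Bp) lam ∧ IsEigenfunction Bm Bp lam u ∧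
    (MemP Bm Bp 0 lam u ∨ (lam = 0 ∧ ∃ x ∈ I, 0 < u x))

end MultiPoint

end

/-! For `lam = s ^ 2 > 0` every solution is a sinusoid. Seen from an end point `ν`, with `1 - ν x`
as the distance to it, a boundary condition is one linear equation in `(sin ψ, cos ψ)`, so it fixes
the angle there modulo `π`: the `phase`. Both conditions hold exactly when the phase sum `F s =
phase₋ + phase₊ + 2 s` is a multiple of `π`. The ratio condition keeps each characteristic vector
within a right angle of a vector in the first quadrant (`inner_pos`). Hence phases exceed `-π/2`,
and membership in `P_0^+` selects `F s = π`.

Positivity rests on a dip argument. With `αᵢ ≥ 0`, a negative phase (or a zero one with `β₀ ≠ 0`)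
forces a contact value of the sine below its end point value. The sine must then have passed its
hump, so `2 phase + 2 s > π`. If `F s = π`, the other phase is then negative too, and adding the two
inequalities contradicts `F s = π`. Thus the sinusoid's argument stays between `0` and `π`. The same
argument excludes `F s = 0`.

Unless both `α₀` vanish, `F` extends continuously to `F 0 < π`. Its first crossing of `π` gives the
least eigenvalue, since before it `F` lies in `(-π, π)` and is nonzero. An energy and convexity
argument shows that an eigenvalue `≤ 0` must be `0`, with both `α₀ = 0` and constant eigenfunctions.
-/

namespace MultiPoint

/-- Cauchy–Schwarz bounds the right side strictly below the norm of `(a * σ, b)`, while `a * c > b *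
σ` makes the left side at least that norm. Applied with `σ = -sin ψ`, `c = cos ψ` at a non-positive
phase `ψ`. -/
theorem not_le_of_mul_sub_pos {p q a b σ c : ℝ}
    (hpq : p ^ 2 + q ^ 2 < 1) (ha : 0 ≤ a) (hb : 0 ≤ b) (hσ : 0 ≤ σ) (hc : 0 < c)
    (hcs : σ ^ 2 + c ^ 2 = 1) (hpos : 0 < σ ∨ 0 < b) (hin : 0 < a * c - b * σ) :
    ¬a * σ + b * c ≤ p * (a * σ) + q * b := by
  intro hle
  have ha' : 0 < a := by
    refine lt_of_le_of_ne ha fun h => ?_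
    rw [← h, zero_mul] at hin
    linarith [mul_nonneg hb hσ]
  have hX : 0 < (a * σ) ^ 2 + b ^ 2 := by
    rcases hpos with h' | h' <;> positivity
  have h1 : (a * σ + b * c) ^ 2 ≤ (p * (a * σ) + q * b) ^ 2 :=
    pow_le_pow_left₀ (by positivity) hle 2
  have h2 : (p * (a * σ) + q * b) ^ 2 ≤ (p ^ 2 + q ^ 2) * ((a * σ) ^ 2 + b ^ 2) := by
    linarith [sq_nonneg (p * b - q * (a * σ)), show (p ^ 2 + q ^ 2) * ((a * σ) ^ 2 + b ^ 2) -
      (p * (a * σ) + q * b) ^ 2 = (p * b - q * (a * σ)) ^ 2 by ring]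
  have h3 : (a * σ) ^ 2 + b ^ 2 ≤ (a * σ + b * c) ^ 2 := by
    have h4 : 0 ≤ (b * σ) * (2 * (a * c) - b * σ) :=
      mul_nonneg (by positivity) (by linarith [mul_nonneg ha hc.le])
    have h5 : b ^ 2 = b ^ 2 * (σ ^ 2 + c ^ 2) := by rw [hcs, mul_one]
    linarith [show (a * σ + b * c) ^ 2 - (a * σ) ^ 2 - b ^ 2 * (σ ^ 2 + c ^ 2) =
      (b * σ) * (2 * (a * c) - b * σ) by ring]
  have h6 : (p ^ 2 + q ^ 2) * ((a * σ) ^ 2 + b ^ 2) < 1 * ((a * σ) ^ 2 + b ^ 2) :=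
    mul_lt_mul_of_pos_right hpq hX
  linarith

/-! ### Characteristic vectors and phases at one end point -/

namespace BC

/-- Real part of the characteristic vector of the condition `B` at the end point `ν`: the solution
`x ↦ sin (ψ + s (1 - ν x))` satisfies `B` iff `(cos ψ, sin ψ)` is parallel to this vector. -/
noncomputable def charRe (B : BC) (ν s : ℝ) : ℝ :=
  B.α₀ - ∑ i, (B.α i * Real.cos (s * (1 - ν * B.η i))
    + s * (ν * B.β i) * Real.sin (s * (1 - ν * B.η i)))

/-- Imaginary part of the characteristic vector. -/
noncomputable def charIm (B : BC) (ν s : ℝ) : ℝ :=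
  s * (ν * B.β₀) + ∑ i, (B.α i * Real.sin (s * (1 - ν * B.η i))
    - s * (ν * B.β i) * Real.cos (s * (1 - ν * B.η i)))

/-- The phase at the end point `ν` of the solutions satisfying `B`. -/
noncomputable def phase (B : BC) (ν s : ℝ) : ℝ := Complex.arg ⟨B.charRe ν s, B.charIm ν s⟩

theorem char_mul_sin_sub (B : BC) (ν s ψ : ℝ) :
    B.charRe ν s * Real.sin ψ - B.charIm ν s * Real.cos ψ =
      B.α₀ * Real.sin ψ - s * (ν * B.β₀) * Real.cos ψ
        - ∑ i, (B.α i * Real.sin (ψ + s * (1 - ν * B.η i))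
          - s * (ν * B.β i) * Real.cos (ψ + s * (1 - ν * B.η i))) := by
  have h : ∑ i, (B.α i * Real.sin (ψ + s * (1 - ν * B.η i))
          - s * (ν * B.β i) * Real.cos (ψ + s * (1 - ν * B.η i))) =
      (∑ i, (B.α i * Real.cos (s * (1 - ν * B.η i))
        + s * (ν * B.β i) * Real.sin (s * (1 - ν * B.η i)))) * Real.sin ψ +
      (∑ i, (B.α i * Real.sin (s * (1 - ν * B.η i))
        - s * (ν * B.β i) * Real.cos (s * (1 - ν * B.η i)))) * Real.cos ψ := by
    rw [Finset.sum_mul, Finset.sum_mul, ← Finset.sum_add_distrib]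
    refine Finset.sum_congr rfl fun i _ => ?_
    rw [Real.sin_add, Real.cos_add]
    ring
  rw [h, charRe, charIm]
  ring

theorem holds_iff (B : BC) {ν s ψ C : ℝ} {u : ℝ → ℝ} (hν : ν * ν = 1) (hC : C ≠ 0)
    (hνI : ν ∈ I) (hη : ∀ i, B.η i ∈ I)
    (hu : ∀ x ∈ I, u x = C * Real.sin (ψ + s * (1 - ν * x)))
    (hDu : ∀ x ∈ I, D u x = -(C * (s * ν * Real.cos (ψ + s * (1 - ν * x))))) :
    B.Holds ν u ↔ B.charRe ν s * Real.sin ψ - B.charIm ν s * Real.cos ψ = 0 := by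
  have h1 : ∑ i, B.α i * u (B.η i) + ∑ i, B.β i * D u (B.η i) =
      C * ∑ i, (B.α i * Real.sin (ψ + s * (1 - ν * B.η i))
          - s * (ν * B.β i) * Real.cos (ψ + s * (1 - ν * B.η i))) := by
    rw [← Finset.sum_add_distrib, Finset.mul_sum]
    refine Finset.sum_congr rfl fun i _ => ?_
    rw [hu _ (hη i), hDu _ (hη i)]
    ring
  rw [BC.Holds, h1, hu _ hνI, hDu _ hνI, char_mul_sin_sub, hν, sub_self, mul_zero, add_zero]
  constructor
  · intro h
    have : C * (B.α₀ * Real.sin ψ - s * (ν * B.β₀) * Real.cos ψ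
        - ∑ i, (B.α i * Real.sin (ψ + s * (1 - ν * B.η i))
          - s * (ν * B.β i) * Real.cos (ψ + s * (1 - ν * B.η i)))) = 0 := by
      linear_combination h
    exact (mul_eq_zero.1 this).resolve_left hC
  · intro h
    linear_combination C * h

/-- The ratio condition in multiplicative form. -/
theorem Admissible.exists_ratio {B : BC} {ν : ℝ} (hB : B.Admissible ν) (hν : ν * ν = 1) :
    ∃ p q : ℝ, 0 ≤ p ∧ 0 ≤ q ∧ p ^ 2 + q ^ 2 < 1 ∧
      ∑ i, |B.α i| = p * B.α₀ ∧ ∑ i, |B.β i| = q * (ν * B.β₀) := by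
  have hSβ : 0 ≤ ∑ i, |B.β i| := Finset.sum_nonneg fun _ _ => abs_nonneg _
  have hinv : ∀ b : ℝ, (∑ i, |B.β i|) / (ν * b) = ν * ((∑ i, |B.β i|) / b) := by
    intro b
    have : ν⁻¹ = ν := inv_eq_of_mul_eq_one_left hν
    rw [div_eq_mul_inv, mul_inv, this]
    ring
  refine ⟨(∑ i, |B.α i|) / B.α₀, (∑ i, |B.β i|) / (ν * B.β₀),
    div_nonneg (Finset.sum_nonneg fun _ _ => abs_nonneg _) hB.α₀_nonneg,
    div_nonneg hSβ hB.β₀_sign, ?_, ?_, ?_⟩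
  · rw [hinv, mul_pow, pow_two ν, hν, one_mul]
    exact hB.ratio
  · by_cases h : B.α₀ = 0
    · rw [hB.α_zero h, h, mul_zero]
    · field_simp
  · by_cases h : B.β₀ = 0
    · rw [hB.β_zero h, h]; simp
    · have : ν ≠ 0 := by rintro rfl; simp at hν
      field_simp

theorem Admissible.mul_β₀_pos {B : BC} {ν : ℝ} (hB : B.Admissible ν) (hν : ν * ν = 1)
    (h : B.β₀ ≠ 0) : 0 < ν * B.β₀ := by
  refine lt_of_le_of_ne hB.β₀_sign fun h0 => h ?_
  have := congrArg (ν * ·) h0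
  simp only [mul_zero, ← mul_assoc, hν, one_mul] at this
  exact this.symm

theorem Admissible.β₀_ne_zero {B : BC} {ν : ℝ} (hB : B.Admissible ν) (h : B.α₀ = 0) :
    B.β₀ ≠ 0 := by
  intro h'
  have := hB.nontrivial
  simp [h, h'] at this

/-- With `R` the length of `(a, b) = (α₀, s ν β₀)`, each contact term is a weight times the inner
product of `(a, b)` with a unit vector, hence at most weight times `R`. The weights add up to `p a +
q b < R` by Cauchy–Schwarz, so the sum cannot consume `R ^ 2`. -/
theorem Admissible.inner_pos {B : BC} {ν s : ℝ} (hB : B.Admissible ν) (hν : ν * ν = 1)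
    (hs : 0 < s) : 0 < B.charRe ν s * B.α₀ + B.charIm ν s * (s * (ν * B.β₀)) := by
  obtain ⟨p, q, hp, hq, hpq, hα, hβ⟩ := hB.exists_ratio hν
  set a := B.α₀ with ha
  set b := s * (ν * B.β₀) with hb
  have ha0 : 0 ≤ a := hB.α₀_nonneg
  have hb0 : 0 ≤ b := mul_nonneg hs.le hB.β₀_sign
  have hpos : 0 < a ^ 2 + b ^ 2 := by
    by_cases h : a = 0
    · have := mul_pos hs (hB.mul_β₀_pos hν (hB.β₀_ne_zero h))
      positivity
    · positivity
  set R := √(a ^ 2 + b ^ 2) with hR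
  have hR0 : 0 < R := Real.sqrt_pos.2 hpos
  have hRR : R ^ 2 = a ^ 2 + b ^ 2 := Real.sq_sqrt hpos.le
  have key : ∀ c d : ℝ, c ^ 2 + d ^ 2 = 1 → |a * c + b * d| ≤ R := by
    intro c d hcd
    apply Real.abs_le_sqrt
    nlinarith [sq_nonneg (a * d - b * c)]
  have hid : B.charRe ν s * a + B.charIm ν s * b = R ^ 2 -
      ∑ i, (B.α i * (a * Real.cos (s * (1 - ν * B.η i)) + b * -Real.sin (s * (1 - ν * B.η i)))
        + s * (ν * B.β i) *
          (a * Real.sin (s * (1 - ν * B.η i)) + b * Real.cos (s * (1 - ν * B.η i)))) := by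
    have h : ∑ i, (B.α i * (a * Real.cos (s * (1 - ν * B.η i))
          + b * -Real.sin (s * (1 - ν * B.η i))) + s * (ν * B.β i) *
          (a * Real.sin (s * (1 - ν * B.η i)) + b * Real.cos (s * (1 - ν * B.η i)))) =
        (∑ i, (B.α i * Real.cos (s * (1 - ν * B.η i))
          + s * (ν * B.β i) * Real.sin (s * (1 - ν * B.η i)))) * a -
        (∑ i, (B.α i * Real.sin (s * (1 - ν * B.η i))
          - s * (ν * B.β i) * Real.cos (s * (1 - ν * B.η i)))) * b := by
      rw [Finset.sum_mul, Finset.sum_mul, ← Finset.sum_sub_distrib]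
      exact Finset.sum_congr rfl fun i _ => by ring
    rw [h, hRR, charRe, charIm, ← ha, ← hb]
    ring
  have hν1 : |ν| = 1 := by
    rcases mul_self_eq_one_iff.1 hν with h | h <;> simp [h]
  have hle : ∑ i, (B.α i * (a * Real.cos (s * (1 - ν * B.η i))
        + b * -Real.sin (s * (1 - ν * B.η i))) + s * (ν * B.β i) *
        (a * Real.sin (s * (1 - ν * B.η i)) + b * Real.cos (s * (1 - ν * B.η i)))) ≤
      (p * a + q * b) * R := by
    have h : (p * a + q * b) * R = ∑ i, (|B.α i| * R + s * |B.β i| * R) := by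
      rw [Finset.sum_add_distrib, ← Finset.sum_mul, ← Finset.sum_mul, ← Finset.mul_sum, hα, hβ, hb]
      ring
    rw [h]
    refine Finset.sum_le_sum fun i _ => add_le_add ?_ ?_
    · refine (le_abs_self _).trans ?_
      rw [abs_mul]
      refine mul_le_mul_of_nonneg_left (key _ _ ?_) (abs_nonneg _)
      rw [neg_sq, Real.cos_sq_add_sin_sq]
    · refine (le_abs_self _).trans ?_
      rw [abs_mul, abs_mul, abs_mul, hν1, one_mul, abs_of_pos hs]
      refine mul_le_mul_of_nonneg_left (key _ _ (Real.sin_sq_add_cos_sq _)) (by positivity)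
  have hlt : p * a + q * b < R := by
    refine lt_of_pow_lt_pow_left₀ 2 hR0.le ?_
    rw [hRR]
    nlinarith [sq_nonneg (p * b - q * a)]
  rw [hid]
  nlinarith

section Phase

variable {B : BC} {ν s : ℝ}

theorem Admissible.char_ne_zero (hB : B.Admissible ν) (hν : ν * ν = 1) (hs : 0 < s) :
    (⟨B.charRe ν s, B.charIm ν s⟩ : ℂ) ≠ 0 := by
  intro h
  have h1 := hB.inner_pos hν hs
  rw [Complex.ext_iff] at h
  simp only [Complex.zero_re, Complex.zero_im] at h
  simp [h.1, h.2] at h1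

theorem Admissible.exists_polar (hB : B.Admissible ν) (hν : ν * ν = 1) (hs : 0 < s) :
    ∃ r, 0 < r ∧ B.charRe ν s = r * Real.cos (B.phase ν s) ∧
      B.charIm ν s = r * Real.sin (B.phase ν s) := by
  have hne := hB.char_ne_zero hν hs
  exact ⟨_, norm_pos_iff.2 hne,
    (Complex.norm_mul_cos_arg ⟨B.charRe ν s, B.charIm ν s⟩).symm,
    (Complex.norm_mul_sin_arg ⟨B.charRe ν s, B.charIm ν s⟩).symm⟩

theorem Admissible.phase_inner_pos (hB : B.Admissible ν) (hν : ν * ν = 1) (hs : 0 < s) :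
    0 < B.α₀ * Real.cos (B.phase ν s) + s * (ν * B.β₀) * Real.sin (B.phase ν s) := by
  obtain ⟨r, hr, h1, h2⟩ := hB.exists_polar hν hs
  have h := hB.inner_pos hν hs
  rw [h1, h2] at h
  refine pos_of_mul_pos_right (a := r) ?_ hr.le
  linarith

theorem Admissible.phase_sol (hB : B.Admissible ν) (hν : ν * ν = 1) (hs : 0 < s) :
    B.charRe ν s * Real.sin (B.phase ν s) - B.charIm ν s * Real.cos (B.phase ν s) = 0 := by
  obtain ⟨r, hr, h1, h2⟩ := hB.exists_polar hν hs
  rw [h1, h2]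
  ring

theorem Admissible.exists_phase_add (hB : B.Admissible ν) (hν : ν * ν = 1) (hs : 0 < s) {ψ : ℝ}
    (h : B.charRe ν s * Real.sin ψ - B.charIm ν s * Real.cos ψ = 0) :
    ∃ n : ℤ, ψ = B.phase ν s + n * Real.pi := by
  obtain ⟨r, hr, h1, h2⟩ := hB.exists_polar hν hs
  rw [h1, h2] at h
  have : Real.sin (ψ - B.phase ν s) = 0 := by
    rw [Real.sin_sub]
    refine (mul_eq_zero.1 (?_ : r * _ = 0)).resolve_left hr.ne'
    linear_combination h
  obtain ⟨n, hn⟩ := Real.sin_eq_zero_iff.1 this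
  exact ⟨n, by linarith⟩

theorem Admissible.neg_pi_div_two_lt_phase (hB : B.Admissible ν) (hν : ν * ν = 1) (hs : 0 < s) :
    -(Real.pi / 2) < B.phase ν s := by
  by_contra! hle
  have h := hB.phase_inner_pos hν hs
  have h1 : -Real.pi < B.phase ν s := Complex.neg_pi_lt_arg _
  have hπ := Real.pi_pos
  have hsin := Real.sin_nonpos_of_nonpos_of_neg_pi_le (x := B.phase ν s) (by linarith) h1.le
  have hcos : Real.cos (B.phase ν s) ≤ 0 := by
    rw [← Real.cos_neg]
    exact Real.cos_nonpos_of_pi_div_two_le_of_le (by linarith) (by linarith)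
  have := mul_nonneg hs.le hB.β₀_sign
  nlinarith [hB.α₀_nonneg]

theorem Admissible.char_mem_slitPlane (hB : B.Admissible ν) (hν : ν * ν = 1) (hs : 0 < s) :
    (⟨B.charRe ν s, B.charIm ν s⟩ : ℂ) ∈ Complex.slitPlane := by
  have h := hB.inner_pos hν hs
  rw [Complex.mem_slitPlane_iff]
  by_contra! hc
  simp only at hc
  rw [hc.2] at h
  nlinarith [hB.α₀_nonneg]

/-- The angle `t` of `(α₀, s ν β₀)` is at distance less than `π / 2` from the phase. -/
theorem Admissible.abs_phase_sub_lt (hB : B.Admissible ν) (hν : ν * ν = 1) (hs : 0 < s) :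
    |B.phase ν s - Complex.arg ⟨B.α₀, s * (ν * B.β₀)⟩| < Real.pi / 2 := by
  set w : ℂ := ⟨B.α₀, s * (ν * B.β₀)⟩ with hw
  have h := hB.phase_inner_pos hν hs
  have hre : B.α₀ = ‖w‖ * Real.cos w.arg := (Complex.norm_mul_cos_arg w).symm
  have him : s * (ν * B.β₀) = ‖w‖ * Real.sin w.arg := (Complex.norm_mul_sin_arg w).symm
  have hcos : 0 < Real.cos (B.phase ν s - w.arg) := by
    rw [Real.cos_sub]
    refine pos_of_mul_pos_right (a := ‖w‖) ?_ (norm_nonneg _)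
    rw [hre, him] at h
    linarith
  have ht0 : 0 ≤ w.arg := Complex.arg_nonneg_iff.2 (mul_nonneg hs.le hB.β₀_sign)
  have ht1 : w.arg ≤ Real.pi / 2 := Complex.arg_le_pi_div_two_iff.2 (Or.inl hB.α₀_nonneg)
  have h1 : -(Real.pi / 2) < B.phase ν s := hB.neg_pi_div_two_lt_phase hν hs
  have h2 : B.phase ν s ≤ Real.pi := Complex.arg_le_pi _
  by_contra! hc
  rw [← Real.cos_abs] at hcos
  refine absurd hcos (not_lt.2 (Real.cos_nonpos_of_pi_div_two_le_of_le hc ?_))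
  rw [abs_le]
  constructor <;> linarith

/-- A non-positive phase forces some contact value below the end point value. -/
theorem Admissible.exists_sin_lt (hB : B.Admissible ν) (hν : ν * ν = 1) (hα : ∀ i, 0 ≤ B.α i)
    (hs : 0 < s) (h : B.phase ν s < 0 ∨ B.phase ν s = 0 ∧ B.β₀ ≠ 0) :
    ∃ i, Real.sin (B.phase ν s + s * (1 - ν * B.η i)) < Real.sin (B.phase ν s) := by
  by_contra! hc
  obtain ⟨p, q, hp, hq, hpq, hSα, hSβ⟩ := hB.exists_ratio hν
  have hin := hB.phase_inner_pos hν hs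
  have hsol := hB.phase_sol hν hs
  rw [char_mul_sin_sub] at hsol
  have hlow := hB.neg_pi_div_two_lt_phase hν hs
  set ψ := B.phase ν s
  have hπ := Real.pi_pos
  have hψ0 : ψ ≤ 0 := by rcases h with h | h <;> linarith
  have hb0 : 0 ≤ s * (ν * B.β₀) := mul_nonneg hs.le hB.β₀_sign
  have hσ : 0 ≤ -Real.sin ψ :=
    neg_nonneg.2 (Real.sin_nonpos_of_nonpos_of_neg_pi_le hψ0 (by linarith))
  have hc0 : 0 < Real.cos ψ := Real.cos_pos_of_mem_Ioo ⟨by linarith, by linarith⟩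
  have hpos : 0 < -Real.sin ψ ∨ 0 < s * (ν * B.β₀) := by
    rcases h with h | h
    · exact Or.inl (neg_pos.2 (Real.sin_neg_of_neg_of_neg_pi_lt h (by linarith)))
    · exact Or.inr (mul_pos hs (hB.mul_β₀_pos hν h.2))
  have hν1 : |ν| = 1 := by
    rcases mul_self_eq_one_iff.1 hν with h | h <;> simp [h]
  -- Here `αᵢ ≥ 0` is essential: it turns the assumed lower bound on the contact sines into one on
  -- the whole sum. The cosines are only bounded by `1`.
  have hge : -(p * B.α₀ * -Real.sin ψ + q * (s * (ν * B.β₀))) ≤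
      ∑ i, (B.α i * Real.sin (ψ + s * (1 - ν * B.η i))
          - s * (ν * B.β i) * Real.cos (ψ + s * (1 - ν * B.η i))) := by
    have e : -(p * B.α₀ * -Real.sin ψ + q * (s * (ν * B.β₀))) =
        ∑ i, (|B.α i| * Real.sin ψ - s * |B.β i|) := by
      rw [Finset.sum_sub_distrib, ← Finset.sum_mul, ← Finset.mul_sum, hSα, hSβ]
      ring
    rw [e]
    refine Finset.sum_le_sum fun i _ => sub_le_sub ?_ ?_
    · rw [abs_of_nonneg (hα i)]
      exact mul_le_mul_of_nonneg_left (hc i) (hα i)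
    · refine (le_abs_self _).trans ?_
      rw [abs_mul, abs_mul, abs_mul, hν1, one_mul, abs_of_pos hs]
      exact mul_le_of_le_one_right (by positivity) (Real.abs_cos_le_one _)
  have hle : B.α₀ * -Real.sin ψ + s * (ν * B.β₀) * Real.cos ψ ≤
      p * (B.α₀ * -Real.sin ψ) + q * (s * (ν * B.β₀)) := by linarith
  refine not_le_of_mul_sub_pos hpq hB.α₀_nonneg hb0 hσ hc0 ?_ hpos ?_ hle
  · rw [neg_sq, Real.sin_sq_add_cos_sq]
  · linarith

/-- The phase extends continuously to `s = 0`. -/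
theorem Admissible.exists_continuous_phase (hB : B.Admissible ν) (hν : ν * ν = 1) :
    ∃ f : ℝ → ℝ, ContinuousOn f (Ici 0) ∧ (∀ s, 0 < s → f s = B.phase ν s) ∧
      f 0 = if B.α₀ = 0 then Real.pi / 2 else 0 := by
  obtain ⟨p, q, hp, hq, hpq, hSα, hSβ⟩ := hB.exists_ratio hν
  have hp1 : p < 1 := by nlinarith
  have hq1 : q < 1 := by nlinarith
  have hν1 : |ν| = 1 := by
    rcases mul_self_eq_one_iff.1 hν with h | h <;> simp [h]
  have mk : ∀ x y : ℝ → ℝ, Continuous x → Continuous y →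
      Continuous fun s => (⟨x s, y s⟩ : ℂ) := by
    intro x y hx hy
    have : (fun s => (⟨x s, y s⟩ : ℂ)) = fun s => (x s : ℂ) + (y s : ℂ) * Complex.I := by
      funext s
      exact Complex.mk_eq_add_mul_I _ _
    rw [this]
    fun_prop
  -- If `α₀ = 0`, all `αᵢ` vanish and the characteristic vector degenerates at `s = 0`. Dividing by
  -- `s > 0` leaves the argument unchanged and gives the limit `(0, y 0)` with `y 0 > 0`, hence `π /
  -- 2`. Otherwise the vector at `s = 0` is already a positive real.
  by_cases h0 : B.α₀ = 0
  · have hαi : ∀ i, B.α i = 0 := by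
      intro i
      have := (Finset.sum_eq_zero_iff_of_nonneg fun i _ => abs_nonneg (B.α i)).1 (hB.α_zero h0) i
        (Finset.mem_univ i)
      exact abs_eq_zero.1 this
    set x : ℝ → ℝ := fun s => -∑ i, ν * B.β i * Real.sin (s * (1 - ν * B.η i)) with hx
    set y : ℝ → ℝ := fun s => ν * B.β₀ - ∑ i, ν * B.β i * Real.cos (s * (1 - ν * B.η i)) with hy
    have hxre : ∀ s, B.charRe ν s = s * x s := by
      intro s
      simp only [charRe, h0, hαi, hx, mul_neg, Finset.mul_sum]
      simp [mul_assoc]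
    have hyim : ∀ s, B.charIm ν s = s * y s := by
      intro s
      simp only [charIm, hαi, hy, mul_sub, Finset.mul_sum]
      simp [mul_assoc, sub_eq_add_neg]
    have hb := hB.mul_β₀_pos hν (hB.β₀_ne_zero h0)
    have hcont := mk x y (by fun_prop) (by fun_prop)
    have hy0 : 0 < y 0 := by
      have : ∑ i, ν * B.β i * Real.cos (0 * (1 - ν * B.η i)) ≤ q * (ν * B.β₀) := by
        rw [← hSβ]
        refine Finset.sum_le_sum fun i _ => ?_
        rw [zero_mul, Real.cos_zero, mul_one]
        refine (le_abs_self _).trans ?_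
        rw [abs_mul, hν1, one_mul]
      simp only [hy]
      nlinarith
    have hx0 : x 0 = 0 := by simp [hx]
    have heq : ∀ s, 0 < s → Complex.arg ⟨x s, y s⟩ = B.phase ν s := by
      intro s hs
      rw [phase, hxre, hyim, show (⟨s * x s, s * y s⟩ : ℂ) = (s : ℂ) * ⟨x s, y s⟩ by
        apply Complex.ext <;> simp, Complex.arg_real_mul _ hs]
    refine ⟨fun s => Complex.arg ⟨x s, y s⟩, ?_, heq, ?_⟩
    · intro s hs
      refine (ContinuousAt.comp (f := fun s => (⟨x s, y s⟩ : ℂ)) (g := Complex.arg)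
        (Complex.continuousAt_arg ?_) hcont.continuousAt).continuousWithinAt
      rcases eq_or_lt_of_le (mem_Ici.1 hs) with h | h
      · subst h
        exact Or.inr hy0.ne'
      · have := hB.char_mem_slitPlane hν h
        rw [hxre, hyim, Complex.mem_slitPlane_iff] at this
        rcases this with h' | h'
        · exact Or.inl (pos_of_mul_pos_right h' h.le)
        · exact Or.inr fun h'' => h' (by simp only at h''; simp [h''])
    · simp only [if_pos h0]
      rw [Complex.arg_eq_pi_div_two_iff]
      exact ⟨hx0, hy0⟩
  · have ha : 0 < B.α₀ := lt_of_le_of_ne hB.α₀_nonneg (Ne.symm h0)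
    have hcont := mk (B.charRe ν) (B.charIm ν) (by unfold charRe; fun_prop)
      (by unfold charIm; fun_prop)
    have hx0 : 0 < B.charRe ν 0 := by
      have : ∑ i, B.α i ≤ p * B.α₀ := by
        rw [← hSα]
        exact Finset.sum_le_sum fun i _ => le_abs_self _
      have e : B.charRe ν 0 = B.α₀ - ∑ i, B.α i := by simp [charRe]
      nlinarith
    have hy0 : B.charIm ν 0 = 0 := by simp [charIm]
    refine ⟨B.phase ν, ?_, fun _ _ => rfl, ?_⟩
    · intro s hs
      refine (ContinuousAt.comp (f := fun s => (⟨B.charRe ν s, B.charIm ν s⟩ : ℂ))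
        (g := Complex.arg) (Complex.continuousAt_arg ?_) hcont.continuousAt).continuousWithinAt
      rcases eq_or_lt_of_le (mem_Ici.1 hs) with h | h
      · subst h
        exact Or.inl hx0
      · exact hB.char_mem_slitPlane hν h
    · rw [if_neg h0, phase, Complex.arg_eq_zero_iff]
      exact ⟨hx0.le, hy0⟩

end Phase

end BC

/-! ### Calculus on the interval; solutions as sinusoids -/

theorem uniqueDiffOn_I : UniqueDiffOn ℝ I := uniqueDiffOn_Icc (by norm_num)

theorem eq_of_hasDerivAt_zero {f : ℝ → ℝ} (hf : ContinuousOn f I)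
    (h : ∀ x ∈ Ioo (-1 : ℝ) 1, HasDerivAt f 0 x) {x y : ℝ} (hx : x ∈ I) (hy : y ∈ I) :
    f x = f y := by
  have hd : DifferentiableOn ℝ f (interior I) := by
    rw [interior_Icc]
    exact fun x hx => (h x hx).differentiableAt.differentiableWithinAt
  have h0 : ∀ x ∈ interior I, deriv f x = 0 := by
    rw [interior_Icc]
    exact fun x hx => (h x hx).deriv
  have h1 := monotoneOn_of_deriv_nonneg (convex_Icc _ _) hf hd fun x hx => (h0 x hx).ge
  have h2 := antitoneOn_of_deriv_nonpos (convex_Icc _ _) hf hd fun x hx => (h0 x hx).le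
  rcases le_total x y with hxy | hxy
  · exact le_antisymm (h1 hx hy hxy) (h2 hx hy hxy)
  · exact le_antisymm (h2 hy hx hxy) (h1 hy hx hxy)

theorem D_congr {u v : ℝ → ℝ} (h : ∀ x ∈ I, u x = v x) {x : ℝ} (hx : x ∈ I) : D u x = D v x :=
  derivWithin_congr h (h x hx)

theorem D_of_hasDerivAt {u : ℝ → ℝ} {u' x : ℝ} (h : HasDerivAt u u' x) (hx : x ∈ I) :
    D u x = u' :=
  h.hasDerivWithinAt.derivWithin (uniqueDiffOn_I x hx)

namespace IsEigenfunction

variable {Bm Bp : BC} {lam : ℝ} {u : ℝ → ℝ}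

theorem continuousOn (h : IsEigenfunction Bm Bp lam u) : ContinuousOn u I :=
  h.contDiffOn.continuousOn

theorem continuousOn_D (h : IsEigenfunction Bm Bp lam u) : ContinuousOn (D u) I :=
  h.contDiffOn.continuousOn_derivWithin uniqueDiffOn_I (by norm_num)

theorem hasDerivAt (h : IsEigenfunction Bm Bp lam u) {x : ℝ} (hx : x ∈ Ioo (-1 : ℝ) 1) :
    HasDerivAt u (D u x) x :=
  (h.contDiffOn.differentiableOn (by norm_num) x
    (Ioo_subset_Icc_self hx)).hasDerivWithinAt.hasDerivAt (Icc_mem_nhds hx.1 hx.2)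

theorem hasDerivAt_D (h : IsEigenfunction Bm Bp lam u) {x : ℝ} (hx : x ∈ Ioo (-1 : ℝ) 1) :
    HasDerivAt (D u) (-(lam * u x)) x := by
  have h1 : ContDiffOn ℝ 1 (D u) I := by
    have := h.contDiffOn
    rw [show (2 : WithTop ℕ∞) = 1 + 1 from by norm_num,
      contDiffOn_succ_iff_derivWithin uniqueDiffOn_I] at this
    exact this.2.2
  have h2 := (h1.differentiableOn (by norm_num) x
    (Ioo_subset_Icc_self hx)).hasDerivWithinAt.hasDerivAt (Icc_mem_nhds hx.1 hx.2)
  have h3 := h.eqn x hx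
  have : derivWithin (D u) I x = -(lam * u x) := by
    rw [← h3, neg_neg]
    rfl
  rwa [this] at h2

/-- Eigenfunctions of a positive eigenvalue are sinusoids. -/
theorem exists_sin (h : IsEigenfunction Bm Bp lam u) {s : ℝ} (hs : 0 < s) (hlam : lam = s ^ 2) :
    ∃ C ψ, 0 < C ∧ ∀ x ∈ I, u x = C * Real.sin (ψ + s * (x + 1)) ∧
      D u x = C * (s * Real.cos (ψ + s * (x + 1))) := by
  -- The modulus and argument of the initial data are the amplitude and phase of the sinusoid.
  set z : ℂ := ⟨D u (-1) / s, u (-1)⟩ with hz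
  have hc : ‖z‖ * Real.cos z.arg = D u (-1) / s := Complex.norm_mul_cos_arg z
  have hsn : ‖z‖ * Real.sin z.arg = u (-1) := Complex.norm_mul_sin_arg z
  have hm1 : (-1 : ℝ) ∈ I := by norm_num [I]
  have dS : ∀ x : ℝ, HasDerivAt (fun x => Real.sin (s * (x + 1)))
      (Real.cos (s * (x + 1)) * s) x := fun x => by
    simpa using (((hasDerivAt_id x).add_const 1).const_mul s).sin
  have dC : ∀ x : ℝ, HasDerivAt (fun x => Real.cos (s * (x + 1)))
      (-Real.sin (s * (x + 1)) * s) x := fun x => by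
    simpa using (((hasDerivAt_id x).add_const 1).const_mul s).cos
  have cS : Continuous (fun x => Real.sin (s * (x + 1))) := by fun_prop
  have cC : Continuous (fun x => Real.cos (s * (x + 1))) := by fun_prop
  -- `h1` and `h2` say that `(u', s u)`, rotated back by `s * (x + 1)`, is constant.
  have h1 : ∀ x ∈ I, s * (u x * Real.cos (s * (x + 1))) - D u x * Real.sin (s * (x + 1)) =
      s * u (-1) := by
    intro x hx
    have := eq_of_hasDerivAt_zero
      (f := fun x => s * (u x * Real.cos (s * (x + 1))) - D u x * Real.sin (s * (x + 1)))
      (((h.continuousOn.mul cC.continuousOn).const_smul s).sub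
        (h.continuousOn_D.mul cS.continuousOn)) (fun x hx => ?_) hx hm1
    · simpa using this
    · refine ((((h.hasDerivAt hx).mul (dC x)).const_mul s).sub
        ((h.hasDerivAt_D hx).mul (dS x))).congr_deriv ?_
      rw [hlam]
      ring
  have h2 : ∀ x ∈ I, s * (u x * Real.sin (s * (x + 1))) + D u x * Real.cos (s * (x + 1)) =
      D u (-1) := by
    intro x hx
    have := eq_of_hasDerivAt_zero
      (f := fun x => s * (u x * Real.sin (s * (x + 1))) + D u x * Real.cos (s * (x + 1)))
      (((h.continuousOn.mul cS.continuousOn).const_smul s).add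
        (h.continuousOn_D.mul cC.continuousOn)) (fun x hx => ?_) hx hm1
    · simpa using this
    · refine ((((h.hasDerivAt hx).mul (dS x)).const_mul s).add
        ((h.hasDerivAt_D hx).mul (dC x))).congr_deriv ?_
      rw [hlam]
      ring
  rw [eq_div_iff hs.ne'] at hc
  have hu : ∀ x ∈ I, u x = ‖z‖ * Real.sin (z.arg + s * (x + 1)) ∧
      D u x = ‖z‖ * (s * Real.cos (z.arg + s * (x + 1))) := by
    intro x hx
    have e1 := h1 x hx
    have e2 := h2 x hx
    have e3 := Real.sin_sq_add_cos_sq (s * (x + 1))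
    rw [← hsn] at e1
    rw [← hc] at e2
    rw [Real.sin_add, Real.cos_add]
    constructor
    · refine mul_left_cancel₀ hs.ne' ?_
      linear_combination (-(s * u x)) * e3 + Real.cos (s * (x + 1)) * e1
        + Real.sin (s * (x + 1)) * e2
    · linear_combination (-D u x) * e3 - Real.sin (s * (x + 1)) * e1
        + Real.cos (s * (x + 1)) * e2
  refine ⟨‖z‖, z.arg, lt_of_le_of_ne (norm_nonneg z) fun h0 => ?_, hu⟩
  obtain ⟨x, hx, hne⟩ := h.nontrivial
  rw [(hu x hx).1, ← h0, zero_mul] at hne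
  exact hne rfl

end IsEigenfunction

theorem D_sin (C s ψ : ℝ) {x : ℝ} (hx : x ∈ I) :
    D (fun x => C * Real.sin (ψ + s * (x + 1))) x = C * (s * Real.cos (ψ + s * (x + 1))) := by
  refine D_of_hasDerivAt ?_ hx
  have : HasDerivAt (fun x => Real.sin (ψ + s * (x + 1))) (Real.cos (ψ + s * (x + 1)) * s) x := by
    simpa using ((((hasDerivAt_id x).add_const 1).const_mul s).const_add ψ).sin
  refine (this.const_mul C).congr_deriv ?_
  ring

theorem D_D_sin (s ψ : ℝ) {x : ℝ} (hx : x ∈ I) :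
    D (D fun x => Real.sin (ψ + s * (x + 1))) x = -(s ^ 2 * Real.sin (ψ + s * (x + 1))) := by
  have h1 : ∀ x ∈ I, D (fun x => Real.sin (ψ + s * (x + 1))) x =
      s * Real.cos (ψ + s * (x + 1)) := fun x hx => by
    simpa using D_sin 1 s ψ hx
  rw [D_congr h1 hx]
  refine D_of_hasDerivAt ?_ hx
  have : HasDerivAt (fun x => Real.cos (ψ + s * (x + 1))) (-Real.sin (ψ + s * (x + 1)) * s) x := by
    simpa using ((((hasDerivAt_id x).add_const 1).const_mul s).const_add ψ).cos
  refine (this.const_mul s).congr_deriv ?_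
  ring

/-! ### Non-positive eigenvalues -/

/-- At an end point where both `|u|` and `|u'|` are maximal and `|u|` does not decrease outwards,
the two terms of the boundary condition vanish. -/
theorem BC.Admissible.terms_eq_zero {B : BC} {ν : ℝ} (hB : B.Admissible ν) (hν : ν * ν = 1)
    {u : ℝ → ℝ} (h : B.Holds ν u) (hu : ∀ x ∈ I, |u x| ≤ |u ν|) (hDu : ∀ x ∈ I, |D u x| ≤ |D u ν|)
    (hsign : 0 ≤ u ν * (ν * D u ν)) : B.α₀ * u ν = 0 ∧ B.β₀ * D u ν = 0 := by
  obtain ⟨p, q, hp, hq, hpq, hSα, hSβ⟩ := hB.exists_ratio hν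
  have hp1 : p < 1 := by nlinarith
  have hq1 : q < 1 := by nlinarith
  have hν1 : |ν| = 1 := by
    rcases mul_self_eq_one_iff.1 hν with h | h <;> simp [h]
  have hr : |∑ i, B.α i * u (B.η i) + ∑ i, B.β i * D u (B.η i)| ≤
      p * B.α₀ * |u ν| + q * (ν * B.β₀) * |D u ν| := by
    refine (abs_add_le _ _).trans (add_le_add ?_ ?_)
    · rw [← hSα, Finset.sum_mul]
      refine (Finset.abs_sum_le_sum_abs _ _).trans (Finset.sum_le_sum fun i _ => ?_)
      rw [abs_mul]
      exact mul_le_mul_of_nonneg_left (hu _ (hB.η_mem i)) (abs_nonneg _)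
    · rw [← hSβ, Finset.sum_mul]
      refine (Finset.abs_sum_le_sum_abs _ _).trans (Finset.sum_le_sum fun i _ => ?_)
      rw [abs_mul]
      exact mul_le_mul_of_nonneg_left (hDu _ (hB.η_mem i)) (abs_nonneg _)
  -- The sign conditions give both terms the same sign, so nothing cancels. Against `hr` with `p, q
  -- < 1`, both must vanish.
  have hl : |B.α₀ * u ν + B.β₀ * D u ν| = B.α₀ * |u ν| + (ν * B.β₀) * |D u ν| := by
    have e : B.α₀ * u ν + B.β₀ * D u ν = B.α₀ * u ν + (ν * B.β₀) * (ν * D u ν) := by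
      linear_combination (-(B.β₀ * D u ν)) * hν
    rw [e, (abs_add_eq_add_abs_iff _ _).2, abs_mul, abs_mul, abs_mul ν (D u ν), hν1, one_mul,
      abs_of_nonneg hB.α₀_nonneg, abs_of_nonneg hB.β₀_sign]
    have hα := hB.α₀_nonneg
    have hβ := hB.β₀_sign
    rcases mul_nonneg_iff.1 hsign with ⟨h1, h2⟩ | ⟨h1, h2⟩
    · exact Or.inl ⟨mul_nonneg hα h1, mul_nonneg hβ h2⟩
    · exact Or.inr ⟨mul_nonpos_of_nonneg_of_nonpos hα h1, mul_nonpos_of_nonneg_of_nonpos hβ h2⟩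
  rw [BC.Holds] at h
  rw [← h, hl] at hr
  have h1 : 0 ≤ B.α₀ * |u ν| := mul_nonneg hB.α₀_nonneg (abs_nonneg _)
  have h2 : 0 ≤ (ν * B.β₀) * |D u ν| := mul_nonneg hB.β₀_sign (abs_nonneg _)
  have h3 : B.α₀ * |u ν| = 0 := by nlinarith
  have h4 : (ν * B.β₀) * |D u ν| = 0 := by nlinarith
  constructor
  · simpa using h3
  · rcases mul_eq_zero.1 h4 with h5 | h5
    · by_cases h6 : B.β₀ = 0
      · rw [h6, zero_mul]
      · exact absurd h5 (hB.mul_β₀_pos hν h6).ne'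
    · rw [abs_eq_zero.1 h5, mul_zero]

/-- A non-positive eigenvalue is `0`, occurs only if both `α₀` vanish, and has constant
eigenfunctions. -/
theorem IsEigenfunction.of_nonpos {Bm Bp : BC} {lam : ℝ} {u : ℝ → ℝ}
    (h : IsEigenfunction Bm Bp lam u) (hm : Bm.Admissible (-1)) (hp : Bp.Admissible 1)
    (hlam : lam ≤ 0) :
    lam = 0 ∧ Bm.α₀ = 0 ∧ Bp.α₀ = 0 ∧ ∃ c, c ≠ 0 ∧ ∀ x ∈ I, u x = c := by
  have hm1 : (-1 : ℝ) ∈ I := by norm_num [I]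
  have hp1 : (1 : ℝ) ∈ I := by norm_num [I]
  have henergy : ∀ x ∈ I, ∀ y ∈ I, D u x ^ 2 + lam * u x ^ 2 = D u y ^ 2 + lam * u y ^ 2 := by
    intro x hx y hy
    refine eq_of_hasDerivAt_zero (f := fun x => D u x ^ 2 + lam * u x ^ 2)
      ((h.continuousOn_D.pow 2).add ((h.continuousOn.pow 2).const_smul lam)) (fun x hx => ?_) hx hy
    refine (((h.hasDerivAt_D hx).pow 2).add (((h.hasDerivAt hx).pow 2).const_mul lam)).congr_deriv ?_
    simp
    ring
  have hw : MonotoneOn (fun x => u x * D u x) I := by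
    have hd : ∀ x ∈ Ioo (-1 : ℝ) 1, HasDerivAt (fun x => u x * D u x)
        (D u x * D u x + u x * -(lam * u x)) x :=
      fun x hx => (h.hasDerivAt hx).mul (h.hasDerivAt_D hx)
    refine monotoneOn_of_deriv_nonneg (convex_Icc _ _) (h.continuousOn.mul h.continuousOn_D) ?_ ?_
    · rw [interior_Icc]
      exact fun x hx => (hd x hx).differentiableAt.differentiableWithinAt
    · rw [interior_Icc]
      intro x hx
      rw [(hd x hx).deriv]
      nlinarith [mul_self_nonneg (D u x), mul_self_nonneg (u x)]
  have hd2 : ∀ x ∈ Ioo (-1 : ℝ) 1, HasDerivAt (fun x => u x ^ 2) (2 * (u x * D u x)) x := by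
    intro x hx
    refine ((h.hasDerivAt hx).pow 2).congr_deriv ?_
    simp
    ring
  have hconv : ConvexOn ℝ I (fun x => u x ^ 2) := by
    refine MonotoneOn.convexOn_of_deriv (convex_Icc _ _) (h.continuousOn.pow 2) ?_ ?_
    · rw [interior_Icc]
      exact fun x hx => (hd2 x hx).differentiableAt.differentiableWithinAt
    · rw [interior_Icc]
      intro x hx y hy hxy
      rw [(hd2 x hx).deriv, (hd2 y hy).deriv]
      have := hw (Ioo_subset_Icc_self hx) (Ioo_subset_Icc_self hy) hxy
      simp only at this
      linarith
  -- `ν` is the end point where the convex function `u ^ 2` is maximal. Since `lam ≤ 0`,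
  -- conservation of energy makes `|u'|` maximal there as well.
  have key : ∀ (B B' : BC) (ν : ℝ), ν * ν = 1 → ν ∈ I → B.Admissible ν → B'.Admissible (-ν) →
      B.Holds ν u → B'.Holds (-ν) u → (∀ x ∈ I, u x ^ 2 ≤ u ν ^ 2) → 0 ≤ u ν * (ν * D u ν) →
      lam = 0 ∧ B.α₀ = 0 ∧ B'.α₀ = 0 ∧ ∃ c, c ≠ 0 ∧ ∀ x ∈ I, u x = c := by
    intro B B' ν hν hνI hB hB' hh hh' hmax hsign
    have hne : u ν ≠ 0 := by
      obtain ⟨x, hx, hx0⟩ := h.nontrivial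
      intro h0
      have := hmax x hx
      rw [h0] at this
      exact hx0 (by nlinarith)
    have hD : ∀ x ∈ I, D u x ^ 2 ≤ D u ν ^ 2 := by
      intro x hx
      have := henergy x hx ν hνI
      nlinarith [hmax x hx]
    obtain ⟨h1, h2⟩ := hB.terms_eq_zero hν hh (fun x hx => sq_le_sq.1 (hmax x hx))
      (fun x hx => sq_le_sq.1 (hD x hx)) hsign
    have hα : B.α₀ = 0 := (mul_eq_zero.1 h1).resolve_right hne
    have hDν : D u ν = 0 := (mul_eq_zero.1 h2).resolve_left (hB.β₀_ne_zero hα)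
    have hD0 : ∀ x ∈ I, D u x = 0 := by
      intro x hx
      have := hD x hx
      rw [hDν] at this
      nlinarith
    have hc : ∀ x ∈ I, u x = u ν := fun x hx =>
      eq_of_hasDerivAt_zero h.continuousOn (fun y hy => by
        have := h.hasDerivAt hy
        rwa [hD0 y (Ioo_subset_Icc_self hy)] at this) hx hνI
    have hν'I : -ν ∈ I := ⟨by linarith [hνI.2], by linarith [hνI.1]⟩
    refine ⟨?_, hα, ?_, u ν, hne, hc⟩
    · have h0 : (0 : ℝ) ∈ Ioo (-1 : ℝ) 1 := by norm_num
      have e : D u =ᶠ[nhds 0] fun _ => (0 : ℝ) := by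
        filter_upwards [Icc_mem_nhds h0.1 h0.2] with x hx using hD0 x hx
      have := (h.hasDerivAt_D h0).unique ((hasDerivAt_const (0 : ℝ) (0 : ℝ)).congr_of_eventuallyEq e)
      rw [hc 0 (Ioo_subset_Icc_self h0), neg_eq_zero] at this
      exact (mul_eq_zero.1 this).resolve_right hne
    · have := (hB'.terms_eq_zero (by rwa [neg_mul_neg]) hh'
        (fun x hx => by rw [hc x hx, hc _ hν'I]) (fun x hx => by rw [hD0 x hx, hD0 _ hν'I])
        (by rw [hD0 _ hν'I]; simp)).1
      rw [hc _ hν'I] at this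
      exact (mul_eq_zero.1 this).resolve_right hne
  have hle : ∀ x ∈ I, u x ^ 2 ≤ max (u (-1) ^ 2) (u 1 ^ 2) := fun x hx =>
    hconv.le_max_of_mem_Icc hm1 hp1 hx
  -- If `u ^ 2` decreased outwards at its maximal end, monotonicity of `u u'` would make `u ^ 2`
  -- strictly monotone the wrong way; `σ = ±1` selects the end.
  have hanti : ∀ σ : ℝ, (∀ x ∈ Ioo (-1 : ℝ) 1, σ * (u x * D u x) < 0) →
      StrictAntiOn (fun x => σ * u x ^ 2) I := by
    intro σ hσ
    refine strictAntiOn_of_deriv_neg (convex_Icc _ _) ((h.continuousOn.pow 2).const_smul σ) ?_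
    rw [interior_Icc]
    intro x hx
    rw [((hd2 x hx).const_mul σ).deriv]
    linarith [hσ x hx]
  rcases le_total (u (-1) ^ 2) (u 1 ^ 2) with hcase | hcase
  · obtain ⟨h1, h2, h3, h4⟩ := key Bp Bm 1 (one_mul 1) hp1 hp hm h.bc_plus h.bc_minus
      (fun x hx => (hle x hx).trans_eq (max_eq_right hcase)) (by
        rw [one_mul]
        by_contra! hneg
        have := hanti 1 (fun x hx => by
          have := hw (Ioo_subset_Icc_self hx) hp1 hx.2.le
          simp only at this
          linarith) hm1 hp1 (by norm_num)
        simp only at this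
        linarith)
    exact ⟨h1, h3, h2, h4⟩
  · refine key Bm Bp (-1) (by norm_num) hm1 hm (by rwa [neg_neg]) h.bc_minus
      (by rw [neg_neg]; exact h.bc_plus) (fun x hx => (hle x hx).trans_eq (max_eq_left hcase)) ?_
    by_contra! hneg
    have := hanti (-1) (fun x hx => by
      have := hw hm1 (Ioo_subset_Icc_self hx) hx.1.le
      simp only at this
      linarith) hm1 hp1 (by norm_num)
    simp only at this
    linarith

/-! ### Interaction of the two phases and the first matching -/

theorem sin_le_sin_of_le_pi_sub {ψ x : ℝ} (h0 : -(Real.pi / 2) ≤ ψ) (h1 : ψ ≤ x)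
    (h2 : x ≤ Real.pi - ψ) : Real.sin ψ ≤ Real.sin x := by
  rcases le_total x (Real.pi / 2) with h | h
  · exact Real.sin_le_sin_of_le_of_le_pi_div_two h0 h h1
  · rw [← Real.sin_pi_sub x]
    exact Real.sin_le_sin_of_le_of_le_pi_div_two h0 (by linarith) (by linarith)

theorem int_eq_zero_of_abs_mul_pi_lt {n : ℤ} (h : |n * Real.pi| < Real.pi) : n = 0 := by
  rw [abs_mul, abs_of_pos Real.pi_pos] at h
  have h1 : |(n : ℝ)| < 1 := by
    have := Real.pi_pos
    by_contra! hc
    nlinarith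
  exact Int.abs_lt_one_iff.1 (by exact_mod_cast h1)

namespace BC.Admissible

/-- Contact arguments lie in `[ψ, ψ + 2 s]`, and the sine stays at least `sin ψ` on `[ψ, π - ψ]`. A
lower contact value therefore needs `ψ + 2 s > π - ψ`. -/
theorem pi_lt_two_mul_phase_add {B : BC} {ν s : ℝ} (hB : B.Admissible ν) (hν : ν * ν = 1)
    (hα : ∀ i, 0 ≤ B.α i) (hs : 0 < s) (h : B.phase ν s < 0 ∨ B.phase ν s = 0 ∧ B.β₀ ≠ 0) :
    Real.pi < 2 * B.phase ν s + 2 * s := by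
  obtain ⟨i, hi⟩ := hB.exists_sin_lt hν hα hs h
  by_contra! hc
  have hη := hB.η_mem i
  have hd : 0 ≤ 1 - ν * B.η i ∧ 1 - ν * B.η i ≤ 2 := by
    rcases mul_self_eq_one_iff.1 hν with rfl | rfl <;> constructor <;> linarith [hη.1, hη.2]
  refine absurd hi (not_lt.2 (sin_le_sin_of_le_pi_sub (hB.neg_pi_div_two_lt_phase hν hs).le ?_ ?_))
  · linarith [mul_nonneg hs.le hd.1]
  · linarith [mul_le_mul_of_nonneg_left hd.2 hs.le]

theorem phase_add_phase_ne_zero {B B' : BC} {ν ν' s : ℝ} (hB : B.Admissible ν)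
    (hB' : B'.Admissible ν') (hν : ν * ν = 1) (hν' : ν' * ν' = 1)
    (hα : ∀ i, 0 ≤ B.α i) (hα' : ∀ i, 0 ≤ B'.α i) (hs : 0 < s) :
    B.phase ν s + B'.phase ν' s + 2 * s ≠ 0 := by
  intro h
  have hπ := Real.pi_pos
  rcases le_total (B.phase ν s) (B'.phase ν' s) with hle | hle
  · have := hB.pi_lt_two_mul_phase_add hν hα hs (Or.inl (by linarith))
    linarith
  · have := hB'.pi_lt_two_mul_phase_add hν' hα' hs (Or.inl (by linarith))
    linarith

theorem phase_nonneg {B B' : BC} {ν ν' s : ℝ} (hB : B.Admissible ν)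
    (hB' : B'.Admissible ν') (hν : ν * ν = 1) (hν' : ν' * ν' = 1)
    (hα : ∀ i, 0 ≤ B.α i) (hα' : ∀ i, 0 ≤ B'.α i) (hs : 0 < s)
    (h : B.phase ν s + B'.phase ν' s + 2 * s = Real.pi) :
    0 ≤ B.phase ν s ∧ (B.β₀ ≠ 0 → 0 < B.phase ν s) := by
  have main : ¬(B.phase ν s < 0 ∨ B.phase ν s = 0 ∧ B.β₀ ≠ 0) := by
    intro hbad
    have h1 := hB.pi_lt_two_mul_phase_add hν hα hs hbad
    have h2 : B'.phase ν' s < 0 := by rcases hbad with h' | h' <;> linarith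
    have h3 := hB'.pi_lt_two_mul_phase_add hν' hα' hs (Or.inl h2)
    linarith
  push Not at main
  exact ⟨main.1, fun hβ => lt_of_le_of_ne main.1 fun h0 => hβ (main.2 h0.symm)⟩

end BC.Admissible

/-- The least `s` at which the phases of the two end points match without interior node. -/
theorem exists_least_matching {Bm Bp : BC} (hm : Bm.Admissible (-1)) (hp : Bp.Admissible 1)
    (h0 : ¬(Bm.α₀ = 0 ∧ Bp.α₀ = 0)) :
    ∃ s, 0 < s ∧ Bm.phase (-1) s + Bp.phase 1 s + 2 * s = Real.pi ∧
      ∀ r, 0 < r → r < s → Bm.phase (-1) r + Bp.phase 1 r + 2 * r < Real.pi := by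
  have hν : (-1 : ℝ) * -1 = 1 := by norm_num
  have hν' : (1 : ℝ) * 1 = 1 := by norm_num
  have hπ := Real.pi_pos
  obtain ⟨f, hfc, hf, hf0⟩ := hm.exists_continuous_phase hν
  obtain ⟨g, hgc, hg, hg0⟩ := hp.exists_continuous_phase hν'
  set h : ℝ → ℝ := fun s => f s + g s + 2 * s with hh
  have hc : ContinuousOn h (Ici 0) := (hfc.add hgc).add (by fun_prop)
  have heq : ∀ s, 0 < s → h s = Bm.phase (-1) s + Bp.phase 1 s + 2 * s := fun s hs => by
    rw [hh]; simp only [hf s hs, hg s hs]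
  -- At most one `α₀` vanishes, so the limiting phase sum is `0` or `π / 2`.
  have hzero : h 0 < Real.pi := by
    simp only [hh, hf0, hg0]
    split_ifs with h1 h2 h2
    · exact absurd ⟨h1, h2⟩ h0
    all_goals linarith
  have hbig : Real.pi ≤ h (2 * Real.pi) := by
    rw [heq _ (by positivity)]
    linarith [hm.neg_pi_div_two_lt_phase hν (s := 2 * Real.pi) (by positivity),
      hp.neg_pi_div_two_lt_phase hν' (s := 2 * Real.pi) (by positivity)]
  have ivt : ∀ b, 0 ≤ b → Real.pi ≤ h b → ∃ s ∈ Icc 0 b, h s = Real.pi := fun b hb hπb =>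
    intermediate_value_Icc hb (hc.mono Icc_subset_Ici_self) ⟨hzero.le, hπb⟩
  have hcompact : IsCompact (Icc 0 (2 * Real.pi) ∩ h ⁻¹' {Real.pi}) :=
    isCompact_Icc.of_isClosed_subset
      ((hc.mono Icc_subset_Ici_self).preimage_isClosed_of_isClosed isClosed_Icc
        isClosed_singleton) inter_subset_left
  obtain ⟨s, ⟨hsI, hsπ⟩, hleast⟩ := hcompact.exists_isLeast (by
    obtain ⟨s, hs, hsπ⟩ := ivt (2 * Real.pi) (by positivity) hbig
    exact ⟨s, hs, hsπ⟩)
  have hsπ' : h s = Real.pi := hsπ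
  have hspos : 0 < s := by
    refine lt_of_le_of_ne hsI.1 fun h' => ?_
    rw [← h'] at hsπ'
    linarith
  refine ⟨s, hspos, by rw [← heq s hspos, hsπ'], fun r hr hrs => ?_⟩
  rw [← heq r hr]
  by_contra! hc'
  obtain ⟨t, ht, htπ⟩ := ivt r hr.le hc'
  have := hleast ⟨⟨ht.1, by linarith [ht.2, hsI.2]⟩, htπ⟩
  linarith [ht.2]

/-! ### From matching phases to eigenfunctions in `P_0^+`, and back -/

section Sinusoid

variable {u : ℝ → ℝ} {C ψ s : ℝ}

theorem BC.Admissible.holds_neg_one_iff {B : BC} (hB : B.Admissible (-1)) (hC : 0 < C)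
    (hu : ∀ x ∈ I, u x = C * Real.sin (ψ + s * (x + 1)) ∧
      D u x = C * (s * Real.cos (ψ + s * (x + 1)))) :
    B.Holds (-1) u ↔ B.charRe (-1) s * Real.sin ψ - B.charIm (-1) s * Real.cos ψ = 0 := by
  refine B.holds_iff (by norm_num) hC.ne' (by norm_num [I]) hB.η_mem (fun x hx => ?_) fun x hx => ?_
  · rw [(hu x hx).1, show (1 - -1 * x : ℝ) = x + 1 by ring]
  · rw [(hu x hx).2, show (1 - -1 * x : ℝ) = x + 1 by ring]
    ring

/-- Since `sin (π - t) = sin t`, reading the sinusoid backwards from `1` gives a sinusoid with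
initial angle `π - ψ - 2 * s`. -/
theorem BC.Admissible.holds_one_iff {B : BC} (hB : B.Admissible 1) (hC : 0 < C)
    (hu : ∀ x ∈ I, u x = C * Real.sin (ψ + s * (x + 1)) ∧
      D u x = C * (s * Real.cos (ψ + s * (x + 1)))) :
    B.Holds 1 u ↔ B.charRe 1 s * Real.sin (Real.pi - ψ - 2 * s)
      - B.charIm 1 s * Real.cos (Real.pi - ψ - 2 * s) = 0 := by
  have e : ∀ x : ℝ, Real.pi - ψ - 2 * s + s * (1 - 1 * x) = Real.pi - (ψ + s * (x + 1)) :=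
    fun x => by ring
  refine B.holds_iff (by norm_num) hC.ne' (by norm_num [I]) hB.η_mem (fun x hx => ?_) fun x hx => ?_
  · rw [(hu x hx).1, e, Real.sin_pi_sub]
  · rw [(hu x hx).2, e, Real.cos_pi_sub]
    ring

theorem isEigenfunction_sin {Bm Bp : BC} (hm : Bm.Admissible (-1)) (hp : Bp.Admissible 1)
    (hs : 0 < s) (h : Bm.phase (-1) s + Bp.phase 1 s + 2 * s = Real.pi) :
    IsEigenfunction Bm Bp (s ^ 2) fun x => Real.sin (Bm.phase (-1) s + s * (x + 1)) := by
  have hu : ∀ x ∈ I, (fun x => Real.sin (Bm.phase (-1) s + s * (x + 1))) x =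
      1 * Real.sin (Bm.phase (-1) s + s * (x + 1)) ∧
      D (fun x => Real.sin (Bm.phase (-1) s + s * (x + 1))) x =
        1 * (s * Real.cos (Bm.phase (-1) s + s * (x + 1))) := fun x hx => by
    refine ⟨(one_mul _).symm, ?_⟩
    rw [← D_sin 1 s _ hx]
    simp only [one_mul]
  refine ⟨?_, fun x hx => ?_, ?_, ?_, ?_⟩
  · exact ContDiff.contDiffOn (by fun_prop)
  · rw [D_D_sin s _ (Ioo_subset_Icc_self hx), neg_neg]
  · exact (hm.holds_neg_one_iff one_pos hu).2 (hm.phase_sol (by norm_num) hs)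
  · rw [hp.holds_one_iff one_pos hu,
      show Real.pi - Bm.phase (-1) s - 2 * s = Bp.phase 1 s by linarith]
    exact hp.phase_sol (by norm_num) hs
  · by_contra! hc
    have h1 := hc (-1) (by norm_num [I])
    have h2 := D_congr (v := fun _ => (0 : ℝ)) hc (x := -1) (by norm_num [I])
    rw [(hu _ (by norm_num [I])).2, D_of_hasDerivAt (hasDerivAt_const _ _) (by norm_num [I])] at h2
    have h3 := Real.sin_sq_add_cos_sq (Bm.phase (-1) s + s * (-1 + 1))
    rw [h1, (mul_eq_zero.1 ((one_mul _).symm.trans h2)).resolve_left hs.ne'] at h3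
    norm_num at h3

end Sinusoid

theorem angleMinus_eq (B : BC) {s : ℝ} (hs : 0 < s) :
    angleMinus B (s ^ 2) = Complex.arg ⟨B.α₀, s * (-1 * B.β₀)⟩ := by
  rw [angleMinus, Real.sqrt_sq hs.le]
  congr 2
  ring

theorem BC.Admissible.anglePlus_eq {B : BC} (hB : B.Admissible 1) {s : ℝ} (hs : 0 < s) :
    anglePlus B (s ^ 2) = Real.pi - Complex.arg ⟨B.α₀, s * (1 * B.β₀)⟩ := by
  have h : Complex.arg ⟨B.α₀, s * (1 * B.β₀)⟩ ≤ Real.pi / 2 :=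
    Complex.arg_le_pi_div_two_iff.2 (Or.inl hB.α₀_nonneg)
  have e : (⟨B.α₀, -(s * B.β₀)⟩ : ℂ) = (starRingEnd ℂ) ⟨B.α₀, s * (1 * B.β₀)⟩ := by
    apply Complex.ext <;> simp
  rw [anglePlus, Real.sqrt_sq hs.le, e, Complex.arg_conj, if_neg, sub_eq_add_neg]
  linarith [Real.pi_pos]

theorem sqrt_D_sq_add {C ψ s : ℝ} (hC : 0 < C) (hs : 0 < s) :
    √((C * (s * Real.cos ψ)) ^ 2 + s ^ 2 * (C * Real.sin ψ) ^ 2) = C * s := by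
  rw [show (C * (s * Real.cos ψ)) ^ 2 + s ^ 2 * (C * Real.sin ψ) ^ 2 =
    (C * s) ^ 2 * (Real.sin ψ ^ 2 + Real.cos ψ ^ 2) by ring, Real.sin_sq_add_cos_sq, mul_one,
    Real.sqrt_sq (by positivity)]

theorem memP_sin {Bm Bp : BC} (hm : Bm.Admissible (-1)) (hp : Bp.Admissible 1) {s : ℝ}
    (hs : 0 < s) (h : Bm.phase (-1) s + Bp.phase 1 s + 2 * s = Real.pi) :
    MemP Bm Bp 0 (s ^ 2) fun x => Real.sin (Bm.phase (-1) s + s * (x + 1)) := by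
  have hDu : ∀ x ∈ I, D (fun x => Real.sin (Bm.phase (-1) s + s * (x + 1))) x =
      s * Real.cos (Bm.phase (-1) s + s * (x + 1)) := fun x hx => by
    simpa using D_sin 1 s (Bm.phase (-1) s) hx
  refine ⟨by positivity, ⟨ContDiff.contDiffOn (by fun_prop), fun x hx => ?_⟩,
    fun x => Bm.phase (-1) s + s * (x + 1), ⟨by fun_prop, fun x hx => ?_⟩, ?_, ?_⟩
  · rw [hDu x hx]
    by_contra! hc
    have h1 : |Real.sin (Bm.phase (-1) s + s * (x + 1))| = 0 :=
      le_antisymm (by linarith [abs_nonneg (s * Real.cos (Bm.phase (-1) s + s * (x + 1)))])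
        (abs_nonneg _)
    have h2 : |s * Real.cos (Bm.phase (-1) s + s * (x + 1))| = 0 := by
      rw [h1, zero_add] at hc
      exact le_antisymm hc (abs_nonneg _)
    rw [abs_eq_zero] at h1 h2
    have h3 := Real.sin_sq_add_cos_sq (Bm.phase (-1) s + s * (x + 1))
    rw [h1, (mul_eq_zero.1 h2).resolve_left hs.ne'] at h3
    norm_num at h3
  · rw [hDu x hx, Real.sqrt_sq hs.le]
    have := sqrt_D_sq_add (ψ := Bm.phase (-1) s + s * (x + 1)) one_pos hs
    simp only [one_mul] at this
    rw [this]
    exact ⟨rfl, rfl⟩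
  · rw [angleMinus_eq _ hs]
    simpa using hm.abs_phase_sub_lt (by norm_num) hs
  · rw [hp.anglePlus_eq hs, ← abs_neg]
    have := hp.abs_phase_sub_lt (by norm_num) hs
    convert this using 2
    push_cast
    linarith

/-- Passing between two multiples of `2π` would meet an odd multiple of `π`, where the cosine is
`-1`. This makes a Prüfer angle unique up to a constant. -/
theorem eq_of_cos_eq_one {f : ℝ → ℝ} (hf : ContinuousOn f I) (h : ∀ x ∈ I, Real.cos (f x) = 1) :
    f 1 = f (-1) := by
  by_contra hne
  have hI : uIcc (-1 : ℝ) 1 = I := uIcc_of_le (by norm_num)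
  have hiv : uIcc (f (-1)) (f 1) ⊆ f '' I := by
    have := intermediate_value_uIcc (a := (-1 : ℝ)) (b := 1) (f := f) (by rwa [hI])
    rwa [hI] at this
  obtain ⟨n, hn⟩ := (Real.cos_eq_one_iff _).1 (h (-1) (by norm_num [I]))
  obtain ⟨m, hm⟩ := (Real.cos_eq_one_iff _).1 (h 1 (by norm_num [I]))
  have hπ := Real.pi_pos
  have hnm : n ≠ m := by
    rintro rfl
    exact hne (by rw [← hm, ← hn])
  have step : ∀ a b : ℤ, a < b → uIcc (a * (2 * Real.pi)) (b * (2 * Real.pi)) ⊆ f '' I → False := by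
    intro a b hab hsub
    have hab' : (a : ℝ) + 1 ≤ b := by exact_mod_cast hab
    obtain ⟨x, hx, hfx⟩ := hsub (show a * (2 * Real.pi) + Real.pi ∈ _ by
      rw [uIcc_of_le (by nlinarith)]
      constructor <;> nlinarith)
    have := h x hx
    rw [hfx, Real.cos_add_pi] at this
    have h1 : Real.cos (a * (2 * Real.pi)) = 1 := (Real.cos_eq_one_iff _).2 ⟨a, rfl⟩
    linarith
  rcases lt_or_gt_of_ne hnm with hlt | hlt
  · exact step n m hlt (by rwa [hn, hm])
  · exact step m n hlt (by rwa [hn, hm, uIcc_comm])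

theorem IsEigenfunction.of_memP {Bm Bp : BC} (hm : Bm.Admissible (-1)) (hp : Bp.Admissible 1)
    {s : ℝ} (hs : 0 < s) {u : ℝ → ℝ} (h : IsEigenfunction Bm Bp (s ^ 2) u)
    (hP : MemP Bm Bp 0 (s ^ 2) u) :
    Bm.phase (-1) s + Bp.phase 1 s + 2 * s = Real.pi ∧
      ∃ C, 0 < C ∧ ∀ x ∈ I, u x = C * Real.sin (Bm.phase (-1) s + s * (x + 1)) := by
  obtain ⟨C, θ, hC, hu⟩ := h.exists_sin hs rfl
  obtain ⟨-, -, ω, ⟨hωc, hω⟩, hωm, hωp⟩ := hP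
  have hcos : ∀ x ∈ I, Real.cos (ω x - (θ + s * (x + 1))) = 1 := by
    intro x hx
    obtain ⟨h1, h2⟩ := hω x hx
    rw [(hu x hx).1, (hu x hx).2, sqrt_D_sq_add hC hs] at h1 h2
    rw [Real.sqrt_sq hs.le] at h2
    have hCs : C * s ≠ 0 := by positivity
    have h1' : Real.cos (θ + s * (x + 1)) = Real.cos (ω x) :=
      mul_left_cancel₀ hCs (by linear_combination h1)
    have h2' : Real.sin (θ + s * (x + 1)) = Real.sin (ω x) :=
      mul_left_cancel₀ hCs (by linear_combination h2)
    rw [Real.cos_sub, h1', h2']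
    linear_combination Real.sin_sq_add_cos_sq (ω x)
  have hconst := eq_of_cos_eq_one (f := fun x => ω x - (θ + s * (x + 1)))
    (hωc.sub (by fun_prop)) hcos
  obtain ⟨k, hk⟩ := (Real.cos_eq_one_iff _).1 (hcos (-1) (by norm_num [I]))
  set ψ := ω (-1) with hψ
  have hθ : θ = ψ - k * (2 * Real.pi) := by linarith
  have hω1 : ω 1 = ψ + 2 * s := by linarith
  have hu' : ∀ x ∈ I, u x = C * Real.sin (ψ + s * (x + 1)) ∧
      D u x = C * (s * Real.cos (ψ + s * (x + 1))) := by
    intro x hx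
    have e : θ + s * (x + 1) = ψ + s * (x + 1) - k * (2 * Real.pi) := by rw [hθ]; ring
    rw [(hu x hx).1, (hu x hx).2, e, Real.sin_sub_int_mul_two_pi, Real.cos_sub_int_mul_two_pi]
    exact ⟨rfl, rfl⟩
  obtain ⟨n, hn⟩ := hm.exists_phase_add (by norm_num) hs
    ((hm.holds_neg_one_iff hC hu').1 h.bc_minus)
  obtain ⟨l, hl⟩ := hp.exists_phase_add (by norm_num) hs ((hp.holds_one_iff hC hu').1 h.bc_plus)
  -- The Prüfer angle and the phase are both within `π / 2` of the same reference angle, so they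
  -- differ by less than `π`; likewise at the other end.
  have hn0 : n = 0 := by
    apply int_eq_zero_of_abs_mul_pi_lt
    have h1 := hm.abs_phase_sub_lt (by norm_num) hs
    rw [angleMinus_eq _ hs] at hωm
    rw [abs_lt] at *
    constructor <;> linarith [h1.1, h1.2, hωm.1, hωm.2]
  have hl0 : l = 0 := by
    apply int_eq_zero_of_abs_mul_pi_lt
    have h1 := hp.abs_phase_sub_lt (by norm_num) hs
    rw [hp.anglePlus_eq hs, hω1] at hωp
    push_cast at hωp
    rw [abs_lt] at *
    constructor <;> linarith [h1.1, h1.2, hωp.1, hωp.2]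
  subst hn0 hl0
  push_cast at hn hl
  have hψ' : ψ = Bm.phase (-1) s := by linarith
  refine ⟨by linarith, C, hC, fun x hx => ?_⟩
  rw [← hψ']
  exact (hu' x hx).1

/-- Positive eigenvalues do not occur below the first matching of the phases. -/
theorem IsEigenfunction.sq_le {Bm Bp : BC} (hm : Bm.Admissible (-1)) (hp : Bp.Admissible 1)
    (hαm : ∀ i, 0 ≤ Bm.α i) (hαp : ∀ i, 0 ≤ Bp.α i) {s r : ℝ} (hr : 0 < r)
    (hs : ∀ r, 0 < r → r < s → Bm.phase (-1) r + Bp.phase 1 r + 2 * r < Real.pi)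
    {u : ℝ → ℝ} (h : IsEigenfunction Bm Bp (r ^ 2) u) : s ≤ r := by
  by_contra! hrs
  obtain ⟨C, ψ, hC, hu⟩ := h.exists_sin hr rfl
  obtain ⟨n, hn⟩ := hm.exists_phase_add (by norm_num) hr
    ((hm.holds_neg_one_iff hC hu).1 h.bc_minus)
  obtain ⟨l, hl⟩ := hp.exists_phase_add (by norm_num) hr ((hp.holds_one_iff hC hu).1 h.bc_plus)
  have h1 := hs r hr hrs
  have h2 := hm.neg_pi_div_two_lt_phase (by norm_num) hr
  have h3 := hp.neg_pi_div_two_lt_phase (by norm_num) hr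
  have e : Bm.phase (-1) r + Bp.phase 1 r + 2 * r = ((1 - n - l : ℤ) : ℝ) * Real.pi := by
    push_cast
    linarith
  -- Both phases exceed `-π / 2`, so below the first matching the phase sum lies in `(-π, π)`.
  have h0 : (1 - n - l : ℤ) = 0 := by
    apply int_eq_zero_of_abs_mul_pi_lt
    rw [← e, abs_lt]
    constructor <;> linarith
  rw [h0, Int.cast_zero, zero_mul] at e
  exact hm.phase_add_phase_ne_zero hp (by norm_num) (by norm_num) hαm hαp hr e

theorem isEigenfunction_one {Bm Bp : BC} (hm : Bm.Admissible (-1)) (hp : Bp.Admissible 1)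
    (h0 : Bm.α₀ = 0 ∧ Bp.α₀ = 0) : IsEigenfunction Bm Bp 0 fun _ => 1 := by
  have hD : ∀ x ∈ I, D (fun _ => (1 : ℝ)) x = 0 := fun x hx =>
    D_of_hasDerivAt (hasDerivAt_const _ _) hx
  have hh : ∀ (B : BC) (ν : ℝ), ν ∈ I → B.Admissible ν → B.α₀ = 0 → B.Holds ν fun _ => 1 := by
    intro B ν hν hB hα
    have hαi : ∀ i, B.α i = 0 := fun i => abs_eq_zero.1 <|
      (Finset.sum_eq_zero_iff_of_nonneg fun i _ => abs_nonneg (B.α i)).1 (hB.α_zero hα) i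
        (Finset.mem_univ i)
    simp [BC.Holds, hα, hαi, hD ν hν, hD _ (hB.η_mem _)]
  refine ⟨contDiffOn_const, fun x hx => ?_, hh _ _ (by norm_num [I]) hm h0.1,
    hh _ _ (by norm_num [I]) hp h0.2, 0, by norm_num [I], one_ne_zero⟩
  have hx' : x ∈ I := Ioo_subset_Icc_self hx
  rw [D_congr hD hx', D_of_hasDerivAt (hasDerivAt_const _ _) hx']
  simp

/-! ### Existence, classification and the main theorem -/

theorem exists_isPrincipalEigenfunction {Bm Bp : BC}
    (hm : Bm.Admissible (-1)) (hp : Bp.Admissible 1)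
    (hαm : ∀ i, 0 ≤ Bm.α i) (hαp : ∀ i, 0 ≤ Bp.α i) :
    ∃ u, IsPrincipalEigenfunction Bm Bp u := by
  by_cases h0 : Bm.α₀ = 0 ∧ Bp.α₀ = 0
  · have h1 := isEigenfunction_one hm hp h0
    refine ⟨_, 0, ⟨⟨_, h1⟩, ?_⟩, h1, Or.inr ⟨rfl, 0, by norm_num [I], one_pos⟩⟩
    rintro lam ⟨v, hv⟩
    by_contra! hlt
    exact hlt.ne (hv.of_nonpos hm hp hlt.le).1
  · obtain ⟨s, hs, hsπ, hmin⟩ := exists_least_matching hm hp h0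
    have h1 := isEigenfunction_sin hm hp hs hsπ
    refine ⟨_, s ^ 2, ⟨⟨_, h1⟩, ?_⟩, h1, Or.inl (memP_sin hm hp hs hsπ)⟩
    rintro lam ⟨v, hv⟩
    have hlam : 0 < lam := by
      by_contra! hle
      obtain ⟨-, h2, h3, -⟩ := hv.of_nonpos hm hp hle
      exact h0 ⟨h2, h3⟩
    rw [← Real.sq_sqrt hlam.le] at hv ⊢
    exact pow_le_pow_left₀ hs.le (hv.sq_le hm hp hαm hαp (Real.sqrt_pos.2 hlam) hmin) 2

/-- A principal eigenfunction is a positive constant or a sinusoid with matching phases. -/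
theorem IsPrincipalEigenfunction.cases {Bm Bp : BC} {u : ℝ → ℝ}
    (h : IsPrincipalEigenfunction Bm Bp u) (hm : Bm.Admissible (-1)) (hp : Bp.Admissible 1) :
    (IsLeast (spectrum Bm Bp) 0 ∧ ∃ c, 0 < c ∧ ∀ x ∈ I, u x = c) ∨
    ∃ s, 0 < s ∧ IsLeast (spectrum Bm Bp) (s ^ 2) ∧
      Bm.phase (-1) s + Bp.phase 1 s + 2 * s = Real.pi ∧
      ∃ C, 0 < C ∧ ∀ x ∈ I, u x = C * Real.sin (Bm.phase (-1) s + s * (x + 1)) := by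
  obtain ⟨lam, hleast, hu, hP | ⟨rfl, x, hx, hux⟩⟩ := h
  · have hlam : 0 < lam := hP.1
    rw [← Real.sq_sqrt hlam.le] at hleast hu hP
    have hs := Real.sqrt_pos.2 hlam
    exact Or.inr ⟨_, hs, hleast, hu.of_memP hm hp hs hP⟩
  · obtain ⟨-, -, -, c, -, hc⟩ := hu.of_nonpos hm hp le_rfl
    exact Or.inl ⟨hleast, c, by rwa [hc x hx] at hux, hc⟩

end MultiPoint

theorem theorem4p9 (Bm Bp : MultiPoint.BC)
    (hm : Bm.Admissible (-1)) (hp : Bp.Admissible 1)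
    (hαm : ∀ i, 0 ≤ Bm.α i) (hαp : ∀ i, 0 ≤ Bp.α i) :
    -- the principal eigenfunction exists and is unique up to a positive factor
    (∃ u₀, MultiPoint.IsPrincipalEigenfunction Bm Bp u₀) ∧
    (∀ u₀ v₀, MultiPoint.IsPrincipalEigenfunction Bm Bp u₀ →
      MultiPoint.IsPrincipalEigenfunction Bm Bp v₀ →
      ∃ c > 0, ∀ x ∈ Set.Icc (-1 : ℝ) 1, v₀ x = c * u₀ x) ∧
    -- it is positive
    (∀ u₀, MultiPoint.IsPrincipalEigenfunction Bm Bp u₀ →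
      (∀ x ∈ Set.Ioo (-1 : ℝ) 1, 0 < u₀ x) ∧
      (Bm.β₀ ≠ 0 → 0 < u₀ (-1)) ∧
      (Bp.β₀ ≠ 0 → 0 < u₀ 1)) := by
  refine ⟨MultiPoint.exists_isPrincipalEigenfunction hm hp hαm hαp, fun u v hu hv => ?_,
    fun u hu => ?_⟩
  · rcases hu.cases hm hp with ⟨hl, c, hc, huc⟩ | ⟨s, hs, hl, -, c, hc, huc⟩ <;>
    rcases hv.cases hm hp with ⟨hl', c', hc', hvc⟩ | ⟨s', hs', hl', -, c', hc', hvc⟩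
    · refine ⟨c' / c, div_pos hc' hc, fun x hx => ?_⟩
      rw [huc x hx, hvc x hx, div_mul_cancel₀ _ hc.ne']
    · exact absurd (hl.unique hl') (pow_pos hs' 2).ne
    · exact absurd (hl'.unique hl) (pow_pos hs 2).ne
    · obtain rfl : s = s' := (pow_left_inj₀ hs.le hs'.le two_ne_zero).1 (hl.unique hl')
      refine ⟨c' / c, div_pos hc' hc, fun x hx => ?_⟩
      rw [huc x hx, hvc x hx, ← mul_assoc, div_mul_cancel₀ _ hc.ne']
  · have hm1 : (-1 : ℝ) ∈ MultiPoint.I := by norm_num [MultiPoint.I]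
    have hp1 : (1 : ℝ) ∈ MultiPoint.I := by norm_num [MultiPoint.I]
    rcases hu.cases hm hp with ⟨-, c, hc, huc⟩ | ⟨s, hs, -, hπ, c, hc, huc⟩
    · exact ⟨fun x hx => by rwa [huc x (Ioo_subset_Icc_self hx)],
        fun _ => by rwa [huc _ hm1], fun _ => by rwa [huc _ hp1]⟩
    · obtain ⟨h1, h1'⟩ := hm.phase_nonneg hp (by norm_num) (by norm_num) hαm hαp hs hπ
      obtain ⟨h2, h2'⟩ := hp.phase_nonneg hm (by norm_num) (by norm_num) hαp hαm hs
        (by rw [← hπ]; ring)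
      refine ⟨fun x hx => ?_, fun hβ => ?_, fun hβ => ?_⟩
      · rw [huc x (Ioo_subset_Icc_self hx)]
        refine mul_pos hc (Real.sin_pos_of_pos_of_lt_pi ?_ ?_)
        · linarith [mul_pos hs (show 0 < x + 1 by linarith [hx.1])]
        -- By `hπ`, the gap from the argument up to `π` is `phase₊ + s * (1 - x)`.
        · linarith [mul_pos hs (show 0 < 1 - x by linarith [hx.2])]
      · rw [huc _ hm1]
        refine mul_pos hc (Real.sin_pos_of_pos_of_lt_pi ?_ ?_) <;> linarith [h1' hβ]
      · rw [huc _ hp1]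
        refine mul_pos hc (Real.sin_pos_of_pos_of_lt_pi ?_ ?_) <;> linarith [h2' hβ]
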